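/- Conventions. Let $\mathcal G\rightrightarrows M$ be a Lie groupoid with source and target maps $s,t:\mathcal G\to M$: the base $M$ is a Hausdorff, second-countable smooth manifold, the arrow space $\mathcal G$ is a smooth manifold (not necessarily Hausdorff or second-countable), all structure maps are smooth, and $s$ is a submersion with Hausdorff fibres. It is *étale* if $s$ is a local diffeomorphism. Let $\pi:M\to M/\mathcal G$ be the projection onto the orbit space. A *transition* of $M$ is a diffeomorphism between open subsets of $M$; a *pseudogroup* on $M$ is a set of transitions that contains $\mathrm{id}_U$ for every open $U\subseteq M$ and is closed under (partially defined) composition, inversion and gluing. The pseudogroup generated by a set of transitions is the smallest pseudogroup containing it, and a pseudogroup is *countably generated* if it is generated by a countable set of transitions. A *bisection* of an étale $\mathcal G$ is a smooth local section $\sigma$ of $s$, defined on an open subset of $M$, such that $t\circ\sigma$ is a diffeomorphism onto an open subset of $M$. The pseudogroup $\Psi(\mathcal G)$ associated to $\mathcal G$ is the one given by the transitions $t\circ\sigma$, $\sigma$ a bisection (precisely: the pseudogroup generated by these transitions, which consists of exactly these transitions whenever they are closed under gluing). A differential form $\alpha$ on $M$ is *$\mathcal G$-basic* if $s^*\alpha=t^*\alpha$.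 The manifold $M$ carries the diffeology whose plots are the smooth maps $P:U\to M$ from open subsets $U$ of Cartesian spaces; $M/\mathcal G$ carries the quotient diffeology, whose plots are the maps $U\to M/\mathcal G$ that are locally of the form $\pi\circ P$ with $P$ a plot of $M$. A *diffeological $k$-form* $\beta$ on a diffeological space assigns to each plot $P:U\to X$ a smooth $k$-form $\beta(P)$ on $U$ such that $\beta(P\circ F)=F^*(\beta(P))$ for all smooth $F:V\to U$, with $V$ open in a Cartesian space. A differential form $\alpha$ on $M$ is identified with the diffeological form $P\mapsto P^*\alpha$. **Lemma 2.** Let $\mathcal G\rightrightarrows M$ be an étale Lie groupoid whose associated pseudogroup $\Psi(\mathcal G)$ is countably generated. Then the pullback by $\pi:M\to M/\mathcal G$ is onto $\mathcal G$-basic forms: for every $k\ge 0$ and every $\mathcal G$-basic $k$-form $\alpha$ on $M$ there is a diffeological $k$-form $\beta$ on $M/\mathcal G$ with $\pi^*\beta=\alpha$, that is, $\beta(\pi\circ P)=P^*\alpha$ for every plot $P:U\to M$. -/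

import Mathlib

open CategoryTheory Set TopologicalSpace
open scoped Manifold ContDiff Topology

namespace EtaleForms

/-! ### Diffeology: plots on open sets, manifold diffeology, quotient diffeology -/

section Diffeology

/-- `p` restricted to `U` is a plot with domain the open set `U ⊆ ℝⁿ`. The structure
`DiffeologicalSpace` records the plots defined on whole Cartesian spaces; the plots on `U` are the
maps whose composition with every smooth `ℝᵐ → U` is one of these. Only the values of `p` on `U`
matter. -/
def IsPlotOn {X : Type*} (D : DiffeologicalSpace X) {n : ℕ}
    (U : Opens (EuclideanSpace ℝ (Fin n))) (p : EuclideanSpace ℝ (Fin n) → X) : Prop :=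
  ∀ (m : ℕ) (f : EuclideanSpace ℝ (Fin m) → EuclideanSpace ℝ (Fin n)),
    ContDiff ℝ ∞ f → (∀ x, f x ∈ U) → p ∘ f ∈ D.plots m

/-- The diffeology of a smooth manifold: the plots are the smooth maps. -/
@[reducible]
def manifoldDiffeology (n : ℕ) (M : Type*) [TopologicalSpace M]
    [ChartedSpace (EuclideanSpace ℝ (Fin n)) M] : DiffeologicalSpace M :=
  .ofCorePlotsOn {
    isPlotOn := fun {m u} _ p ↦ ContMDiffOn (𝓡 m) (𝓡 n) ∞ p u
    isPlotOn_congr := fun _ _ _ h ↦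
      ⟨fun hp ↦ hp.congr fun x hx ↦ (h hx).symm, fun hp ↦ hp.congr fun x hx ↦ h hx⟩
    isPlot_const := fun _ ↦ contMDiffOn_const
    isPlotOn_reparam := fun _ _ _ h hp hf ↦ hp.comp hf.contMDiffOn h
    locality := fun _ _ h x hx ↦ by
      obtain ⟨v, hv, hxv, hp⟩ := h x hx
      exact ((hp x hxv).contMDiffAt (hv.mem_nhds hxv)).contMDiffWithinAt }

/-- The quotient diffeology on `X/r`: a parametrization is a plot when it locally lifts to plots
of `X`. -/
@[reducible]
def quotientDiffeology {X : Type*} (D : DiffeologicalSpace X) (r : Setoid X) :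
    DiffeologicalSpace (Quotient r) :=
  .ofCorePlotsOn {
    isPlotOn := fun {n u} _ p ↦ ∀ x ∈ u, ∃ V : Opens (EuclideanSpace ℝ (Fin n)), x ∈ V ∧
      (V : Set (EuclideanSpace ℝ (Fin n))) ⊆ u ∧ ∃ q : EuclideanSpace ℝ (Fin n) → X,
        IsPlotOn D V q ∧ EqOn p (Quotient.mk r ∘ q) V
    isPlotOn_congr := fun {n u} _ p q h ↦ by
      constructor
      · intro H x hx
        obtain ⟨V, hxV, hVu, l, hl, hpl⟩ := H x hx
        exact ⟨V, hxV, hVu, l, hl, fun y hy ↦ (h (hVu hy)).symm.trans (hpl hy)⟩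
      · intro H x hx
        obtain ⟨V, hxV, hVu, l, hl, hpl⟩ := H x hx
        exact ⟨V, hxV, hVu, l, hl, fun y hy ↦ (h (hVu hy)).trans (hpl hy)⟩
    isPlot_const := fun {n} c ↦ by
      obtain ⟨a, rfl⟩ := Quotient.exists_rep c
      exact fun x _ ↦ ⟨⊤, trivial, subset_univ _, fun _ ↦ a,
        fun m f _ _ ↦ D.constant_plots a, fun _ _ ↦ rfl⟩
    isPlotOn_reparam := fun {_ _ _ v _} hv {_ f} h hp hf x hx ↦ by
      obtain ⟨V, hxV, hVu, l, hl, hpl⟩ := hp (f x) (h hx)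
      refine ⟨⟨v ∩ f ⁻¹' V, hf.continuousOn.isOpen_inter_preimage hv V.isOpen⟩, ⟨hx, hxV⟩,
        inter_subset_left, l ∘ f, fun k g hg hgV ↦ ?_, fun y hy ↦ hpl hy.2⟩
      exact hl k (f ∘ g) (hf.comp_contDiff hg fun y ↦ (hgV y).1) fun y ↦ (hgV y).2
    locality := fun {_ _} hu _ H x hx ↦ by
      obtain ⟨v, hv, hxv, hp⟩ := H x hx
      obtain ⟨V, hxV, hVv, l, hl, hpl⟩ := hp x hxv
      exact ⟨V ⊓ ⟨_, hu⟩, ⟨hxV, hx⟩, inter_subset_right, l,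
        fun m f hf hfV ↦ hl m f hf fun y ↦ (hfV y).1, fun y hy ↦ hpl hy.1⟩ }

lemma IsPlotOn.mk_comp {X : Type*} {D : DiffeologicalSpace X} (r : Setoid X) {n : ℕ}
    {U : Opens (EuclideanSpace ℝ (Fin n))} {p : EuclideanSpace ℝ (Fin n) → X}
    (hp : IsPlotOn D U p) : IsPlotOn (quotientDiffeology D r) U (Quotient.mk r ∘ p) :=
  fun _ f hf hfU _ _ ↦ ⟨⊤, trivial, subset_univ _, p ∘ f,
    fun k g hg _ ↦ hp k (f ∘ g) (hf.comp hg) fun y ↦ hfU (g y), fun _ _ ↦ rfl⟩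

/-- A diffeological `k`-form: to every plot with open domain `U` in a Cartesian space it assigns a
smooth `k`-form on `U`, compatibly with smooth changes of parameters. A form on `U` is recorded by
its values on `U`; in `pullback`, the plot `q` on `V` is the plot `p ∘ F`. -/
structure DiffeologicalForm {X : Type*} (D : DiffeologicalSpace X) (k : ℕ) where
  /-- The form assigned to a plot. -/
  toFun : ∀ {n : ℕ} (U : Opens (EuclideanSpace ℝ (Fin n))) (p : EuclideanSpace ℝ (Fin n) → X),
    IsPlotOn D U p → EuclideanSpace ℝ (Fin n) → EuclideanSpace ℝ (Fin n) [⋀^Fin k]→L[ℝ] ℝ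
  smooth : ∀ {n : ℕ} (U : Opens (EuclideanSpace ℝ (Fin n))) (p : EuclideanSpace ℝ (Fin n) → X)
    (hp : IsPlotOn D U p), ContDiffOn ℝ ∞ (toFun U p hp) U
  pullback : ∀ {m n : ℕ} (V : Opens (EuclideanSpace ℝ (Fin m)))
    (U : Opens (EuclideanSpace ℝ (Fin n))) (q : EuclideanSpace ℝ (Fin m) → X)
    (p : EuclideanSpace ℝ (Fin n) → X) (hq : IsPlotOn D V q) (hp : IsPlotOn D U p)
    (F : EuclideanSpace ℝ (Fin m) → EuclideanSpace ℝ (Fin n)),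
    ContDiffOn ℝ ∞ F V → MapsTo F V U → EqOn q (p ∘ F) V →
    ∀ x ∈ V, toFun V q hq x = (toFun U p hp (F x)).compContinuousLinearMap (fderiv ℝ F x)

end Diffeology

/-! ### Differential forms on manifolds -/

section Forms

/-- A smooth differential `k`-form on an `n`-manifold: a family of alternating `k`-forms on the
tangent spaces whose expression in every chart of the atlas is smooth. -/
structure DifferentialForm (n : ℕ) (M : Type*) [TopologicalSpace M]
    [ChartedSpace (EuclideanSpace ℝ (Fin n)) M] (k : ℕ) where
  /-- The value of the form at a point. -/
  toFun : ∀ x : M, TangentSpace (𝓡 n) x [⋀^Fin k]→L[ℝ] ℝ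
  smooth : ∀ φ ∈ atlas (EuclideanSpace ℝ (Fin n)) M,
    ContDiffOn ℝ ∞ (fun y ↦ ((toFun (φ.symm y)).compContinuousLinearMap
      (mfderiv (𝓡 n) (𝓡 n) φ.symm y) : EuclideanSpace ℝ (Fin n) [⋀^Fin k]→L[ℝ] ℝ)) φ.target

/-- The value at `x` of the pullback `f^* α` of a form along `f : N → M`. -/
noncomputable def DifferentialForm.pullbackAt {n m k : ℕ} {M N : Type*}
    [TopologicalSpace M] [ChartedSpace (EuclideanSpace ℝ (Fin n)) M]
    [TopologicalSpace N] [ChartedSpace (EuclideanSpace ℝ (Fin m)) N]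
    (α : DifferentialForm n M k) (f : N → M) (x : N) : TangentSpace (𝓡 m) x [⋀^Fin k]→L[ℝ] ℝ :=
  (α.toFun (f x)).compContinuousLinearMap (mfderiv (𝓡 m) (𝓡 n) f x)

/-- `π^* β = α`, where `π : M → M/r` is the quotient map, `β` is a diffeological form on `M/r` for
the quotient diffeology, and the form `α` on the manifold `M` is regarded as the diffeological form
`P ↦ P^* α`: for every plot `P : U → M` one has `β(π ∘ P) = P^* α` on `U`. -/
def IsQuotientPullback {n k : ℕ} {M : Type*} [TopologicalSpace M]
    [ChartedSpace (EuclideanSpace ℝ (Fin n)) M] (r : Setoid M)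
    (β : DiffeologicalForm (quotientDiffeology (manifoldDiffeology n M) r) k)
    (α : DifferentialForm n M k) : Prop :=
  ∀ (m : ℕ) (U : Opens (EuclideanSpace ℝ (Fin m))) (P : EuclideanSpace ℝ (Fin m) → M)
    (hP : IsPlotOn (manifoldDiffeology n M) U P), ∀ x ∈ U,
    β.toFun U (Quotient.mk r ∘ P) (hP.mk_comp r) x = α.pullbackAt P x

end Forms

/-! ### Pseudogroups -/

section Pseudogroup

variable (n : ℕ) {M : Type*} [TopologicalSpace M] [ChartedSpace (EuclideanSpace ℝ (Fin n)) M]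

/-- A transition: a diffeomorphism between open subsets of `M`. -/
def IsTransition (e : OpenPartialHomeomorph M M) : Prop :=
  ContMDiffOn (𝓡 n) (𝓡 n) ∞ e e.source ∧ ContMDiffOn (𝓡 n) (𝓡 n) ∞ e.symm e.target

/-- A pseudogroup on the manifold `M`: a set of transitions that contains the identity of every
open set and is closed under (partially defined) composition, inversion and gluing. The last three
closure properties are those of a `StructureGroupoid` (which also ignores the irrelevant values of
a transition outside its domain). -/
structure IsPseudogroup (P : StructureGroupoid M) : Prop where
  isTransition : ∀ e ∈ P, IsTransition n e
  id_mem : ∀ U : Opens M, OpenPartialHomeomorph.ofSet (U : Set M) U.isOpen ∈ P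

/-- The pseudogroup generated by a set `A` of transitions: the intersection of all pseudogroups
that contain `A`. -/
def generatedPseudogroup (A : Set (OpenPartialHomeomorph M M)) : Set (OpenPartialHomeomorph M M) :=
  {e | ∀ P : StructureGroupoid M, IsPseudogroup n P → (∀ a ∈ A, a ∈ P) → e ∈ P}

/-- The pseudogroup `P` (given by its set of members) is generated by a countable set of
transitions. -/
def IsCountablyGenerated (P : Set (OpenPartialHomeomorph M M)) : Prop :=
  ∃ A : Set (OpenPartialHomeomorph M M), A.Countable ∧ (∀ a ∈ A, IsTransition n a) ∧
    generatedPseudogroup n A = P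

end Pseudogroup

/-! ### Lie groupoids -/

section LieGroupoid

/-- The arrows of a category with set of objects `M`. -/
structure Arrows (M : Type*) [Quiver M] where
  /-- The source of an arrow. -/
  source : M
  /-- The target of an arrow. -/
  target : M
  /-- The arrow itself. -/
  hom : source ⟶ target

variable {M : Type*} [Groupoid M]

/-- The unit arrow at `x`. -/
def Arrows.unit (x : M) : Arrows M := ⟨x, x, 𝟙 x⟩

/-- The inverse of an arrow. -/
def Arrows.inv (g : Arrows M) : Arrows M := ⟨g.target, g.source, Groupoid.inv g.hom⟩

open Classical in
/-- The product `g h` (first `h`, then `g`) of a composable pair `(g, h)`, that is, a pair with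
`s(g) = t(h)`; on other pairs the value is irrelevant. -/
noncomputable def Arrows.mul (p : Arrows M × Arrows M) : Arrows M :=
  if c : p.2.target = p.1.source then ⟨p.2.source, p.1.target, p.2.hom ≫ eqToHom c ≫ p.1.hom⟩
  else p.1

variable (M) in
/-- Two points are equivalent if there is an arrow from one to the other. The classes are the
orbits, and the quotient is the orbit space. -/
def orbitSetoid : Setoid M where
  r x y := Nonempty (x ⟶ y)
  iseqv := ⟨fun x ↦ ⟨𝟙 x⟩, fun ⟨f⟩ ↦ ⟨Groupoid.inv f⟩, fun ⟨f⟩ ⟨g⟩ ↦ ⟨f ≫ g⟩⟩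

variable (n m : ℕ) (M) [TopologicalSpace M] [ChartedSpace (EuclideanSpace ℝ (Fin n)) M]
  [TopologicalSpace (Arrows M)] [ChartedSpace (EuclideanSpace ℝ (Fin m)) (Arrows M)]

/-- A Lie groupoid: the base `M` is a Hausdorff second-countable smooth `n`-manifold, the arrows
form a smooth `m`-manifold (not necessarily Hausdorff or second-countable), all structure maps are
smooth, and the source map is a submersion with Hausdorff fibres. -/
structure IsLieGroupoid : Prop where
  base_t2 : T2Space M
  base_secondCountable : SecondCountableTopology M
  base_isManifold : IsManifold (𝓡 n) ∞ M
  arrows_isManifold : IsManifold (𝓡 m) ∞ (Arrows M)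
  contMDiff_source : ContMDiff (𝓡 m) (𝓡 n) ∞ (Arrows.source : Arrows M → M)
  contMDiff_target : ContMDiff (𝓡 m) (𝓡 n) ∞ (Arrows.target : Arrows M → M)
  contMDiff_unit : ContMDiff (𝓡 n) (𝓡 m) ∞ (Arrows.unit : M → Arrows M)
  contMDiff_inv : ContMDiff (𝓡 m) (𝓡 m) ∞ (Arrows.inv : Arrows M → Arrows M)
  contMDiffOn_mul : ContMDiffOn ((𝓡 m).prod (𝓡 m)) (𝓡 m) ∞ (Arrows.mul : _ → Arrows M)
    {p : Arrows M × Arrows M | p.2.target = p.1.source}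
  isSubmersion_source : Manifold.IsSubmersion (𝓡 m) (𝓡 n) ∞ (Arrows.source : Arrows M → M)
  t2_sourceFiber : ∀ x : M, T2Space {g : Arrows M // g.source = x}

/-- The groupoid is étale: the source map is étale, i.e. a local diffeomorphism. -/
def IsEtale : Prop := IsLocalDiffeomorph (𝓡 m) (𝓡 n) ∞ (Arrows.source : Arrows M → M)

/-- The transitions `t ∘ σ` of `M`, where `σ` is a bisection: a smooth local section of the source
map such that `t ∘ σ` is a diffeomorphism between open subsets of `M`. -/
def bisectionTransitions : Set (OpenPartialHomeomorph M M) :=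
  {e | IsTransition n e ∧ ∃ σ : M → Arrows M, ContMDiffOn (𝓡 n) (𝓡 m) ∞ σ e.source ∧
    ∀ x ∈ e.source, (σ x).source = x ∧ (σ x).target = e x}

/-- The pseudogroup on `M` associated to an étale groupoid: the one consisting of the transitions
`t ∘ σ`, `σ` a bisection. Where the set of these transitions is not closed under gluing (local
bisections `σ` inducing a given transition need not glue), it is completed to the pseudogroup that
it generates. -/
def associatedPseudogroup : Set (OpenPartialHomeomorph M M) :=
  generatedPseudogroup n (bisectionTransitions M n m)

variable {M n}

/-- A form on the base is basic if `s^* α = t^* α`. -/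
def IsBasic {k : ℕ} (α : DifferentialForm n M k) : Prop :=
  ∀ g : Arrows M, α.pullbackAt (m := m) Arrows.source g = α.pullbackAt (m := m) Arrows.target g

end LieGroupoid

end EtaleForms

open EtaleForms

/-! The value of `β` on a plot `p` of the orbit space is forced: it is `P^* α` for a local smooth
lift `P` of `p`. What needs proof is that two lifts `P`, `Q` of the same plot give the same form
(`pullbackAt_eq_of_eqOn_quotient`). At each parameter `y` some arrow joins `P y` to `Q y`, but
nothing makes it depend continuously on `y`.

Étaleness puts a bisection through this arrow, so a transition in the pseudogroup takes `P y` to `Q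
y`. By `exists_isWord_of_mem_generatedPseudogroup`, so does a word `w` in countably many generators.
All these words preserve `α`, because the transitions preserving `α` form a pseudogroup that
contains the bisection transitions (`bisectionTransitions_subset_stabilizer`).

Suppose the two pullbacks differ somewhere. The set `O` where they differ is open, and it is covered
by the countably many sets where `w ∘ P = Q`, each locally closed because `M` is Hausdorff. By Baire
(`exists_inter_interior_nonempty_of_isLocallyClosed`), one of them has an interior point in `O`.
Near that point `Q = w ∘ P`, hence `Q^* α = P^* w^* α = P^* α` there, a contradiction. -/

namespace EtaleForms

/-! ### Smooth dependence of the pullback of alternating forms -/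

section Alternating

variable {E F G : Type*} [NormedAddCommGroup E] [NormedSpace ℝ E] [NormedAddCommGroup F]
  [NormedSpace ℝ F] [NormedAddCommGroup G] [NormedSpace ℝ G] {k : ℕ}

variable (E G k) in
/-- Alternatization of continuous multilinear maps, as a continuous linear map. -/
noncomputable def alternatizationCLM :
    ContinuousMultilinearMap ℝ (fun _ : Fin k ↦ E) G →L[ℝ] E [⋀^Fin k]→L[ℝ] G :=
  LinearMap.mkContinuous
    { toFun := ContinuousMultilinearMap.alternatization
      map_add' := map_add _
      map_smul' := fun c f ↦ by
        ext v
        simp [ContinuousMultilinearMap.alternatization_apply_apply, Finset.smul_sum, smul_comm c] }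
    -- The alternatization is a sum over `k!` permutations, each term bounded by `‖f‖ * ∏ i, ‖v i‖`.
    (k.factorial : ℝ) fun f ↦ by
      refine ContinuousAlternatingMap.opNorm_le_bound _ (by positivity) fun v ↦ ?_
      simp only [LinearMap.coe_mk, AddHom.coe_mk,
        ContinuousMultilinearMap.alternatization_apply_apply]
      refine (norm_sum_le _ _).trans ?_
      have h : ∀ σ ∈ (Finset.univ : Finset (Equiv.Perm (Fin k))),
          ‖Equiv.Perm.sign σ • f (v ∘ σ)‖ ≤ ‖f‖ * ∏ i, ‖v i‖ := fun σ _ ↦ by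
        have h₁ : ‖Equiv.Perm.sign σ • f (v ∘ σ)‖ = ‖f (v ∘ σ)‖ := by
          rcases Int.units_eq_one_or (Equiv.Perm.sign σ) with h | h <;> simp [h]
        rw [h₁]
        refine (f.le_opNorm _).trans_eq ?_
        congr 1
        exact Equiv.prod_comp σ fun i ↦ ‖v i‖
      refine (Finset.sum_le_sum h).trans_eq ?_
      simp [Fintype.card_perm, mul_assoc]

/-- All `k!` terms of the sum agree on an alternating map. Dividing by `k!` thus gives a continuous
linear left inverse of the inclusion into multilinear maps, through which smoothness passes back to
alternating maps. -/
lemma alternatizationCLM_coe (f : E [⋀^Fin k]→L[ℝ] G) :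
    alternatizationCLM E G k f.toContinuousMultilinearMap = (k.factorial : ℝ) • f := by
  ext v
  have h := DFunLike.congr_fun (AlternatingMap.coe_alternatization f.toAlternatingMap) v
  simp only [MultilinearMap.alternatization_apply, Fintype.card_fin] at h
  simpa [alternatizationCLM, ContinuousMultilinearMap.alternatization_apply_apply,
    Function.comp_def, Nat.cast_smul_eq_nsmul] using h

/-- The pullback of alternating forms along linear maps is smooth in both arguments jointly. -/
lemma contDiff_compContinuousLinearMap {r : WithTop ℕ∞} :
    ContDiff ℝ r fun p : (F [⋀^Fin k]→L[ℝ] G) × (E →L[ℝ] F) ↦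
      p.1.compContinuousLinearMap p.2 := by
  -- Pullback of multilinear maps is itself multilinear in the `k`-tuple of linear maps; here it is
  -- restricted to the diagonal.
  have h₁ : ContDiff ℝ r fun p : (F [⋀^Fin k]→L[ℝ] G) × (E →L[ℝ] F) ↦
      ContinuousMultilinearMap.compContinuousLinearMapContinuousMultilinear ℝ
        (fun _ : Fin k ↦ E) (fun _ : Fin k ↦ F) G (fun _ ↦ p.2) :=
    (ContinuousMultilinearMap.contDiff _).comp (contDiff_pi.2 fun _ ↦ contDiff_snd)
  have h₂ : ContDiff ℝ r fun p : (F [⋀^Fin k]→L[ℝ] G) × (E →L[ℝ] F) ↦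
      ContinuousAlternatingMap.toContinuousMultilinearMapCLM ℝ p.1 :=
    (ContinuousLinearMap.contDiff _).comp contDiff_fst
  have h₃ := (contDiff_const (c := (k.factorial : ℝ)⁻¹)).smul
    ((alternatizationCLM E G k).contDiff.comp (h₁.clm_apply h₂))
  convert h₃ using 2 with p
  have h₄ := alternatizationCLM_coe (p.1.compContinuousLinearMap p.2)
  exact (eq_inv_smul_iff₀ (by positivity : (k.factorial : ℝ) ≠ 0)).2 h₄.symm

end Alternating

/-! ### Pullback of differential forms -/

section Pullback

variable {n k : ℕ} {M : Type*} [TopologicalSpace M] [ChartedSpace (EuclideanSpace ℝ (Fin n)) M]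
  {l m : ℕ} {N : Type*} [TopologicalSpace N] [ChartedSpace (EuclideanSpace ℝ (Fin m)) N]
  {L : Type*} [TopologicalSpace L] [ChartedSpace (EuclideanSpace ℝ (Fin l)) L]
  (α : DifferentialForm n M k)

lemma DifferentialForm.pullbackAt_congr {f g : N → M} {x : N} (h : f =ᶠ[𝓝 x] g) :
    α.pullbackAt (m := m) f x = α.pullbackAt (m := m) g x := by
  unfold DifferentialForm.pullbackAt
  rw [h.mfderiv_eq, h.eq_of_nhds]

lemma DifferentialForm.pullbackAt_id (x : M) : α.pullbackAt (m := n) id x = α.toFun x := by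
  unfold DifferentialForm.pullbackAt
  rw [mfderiv_id]
  rfl

lemma DifferentialForm.pullbackAt_comp {g : N → M} {f : L → N} {x : L}
    (hg : MDifferentiableAt (𝓡 m) (𝓡 n) g (f x)) (hf : MDifferentiableAt (𝓡 l) (𝓡 m) f x) :
    α.pullbackAt (m := l) (g ∘ f) x =
      (α.pullbackAt (m := m) g (f x)).compContinuousLinearMap (mfderiv (𝓡 l) (𝓡 m) f x) := by
  unfold DifferentialForm.pullbackAt
  rw [mfderiv_comp x hg hf]
  rfl

/-- By the chain rule, agreement at the single point `f x` suffices. Every use of invariance or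
basicness of `α` goes through this form. -/
lemma DifferentialForm.pullbackAt_comp_of_eq {g h : N → M} {f : L → N} {x : L}
    (hg : MDifferentiableAt (𝓡 m) (𝓡 n) g (f x)) (hh : MDifferentiableAt (𝓡 m) (𝓡 n) h (f x))
    (hf : MDifferentiableAt (𝓡 l) (𝓡 m) f x)
    (H : α.pullbackAt (m := m) g (f x) = α.pullbackAt (m := m) h (f x)) :
    α.pullbackAt (m := l) (g ∘ f) x = α.pullbackAt (m := l) (h ∘ f) x := by
  rw [α.pullbackAt_comp hg hf, α.pullbackAt_comp hh hf]
  exact congrArg (fun η : EuclideanSpace ℝ (Fin m) [⋀^Fin k]→L[ℝ] ℝ ↦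
    η.compContinuousLinearMap (mfderiv (𝓡 l) (𝓡 m) f x)) H

/-- Pullbacks of smooth forms along smooth maps from Cartesian spaces are smooth. -/
lemma DifferentialForm.contDiffAt_pullbackAt [IsManifold (𝓡 n) ∞ M]
    {P : EuclideanSpace ℝ (Fin m) → M} {x : EuclideanSpace ℝ (Fin m)}
    (hP : ContMDiffAt (𝓡 m) (𝓡 n) ∞ P x) :
    ContDiffAt ℝ ∞ (F := EuclideanSpace ℝ (Fin m) [⋀^Fin k]→L[ℝ] ℝ)
      (fun y ↦ α.pullbackAt (m := m) P y) x := by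
  set φ := chartAt (EuclideanSpace ℝ (Fin n)) (P x)
  have hx : P x ∈ φ.source := mem_chart_source _ _
  have hm : φ ∈ IsManifold.maximalAtlas (𝓡 n) ∞ M := IsManifold.chart_mem_maximalAtlas _
  set h : EuclideanSpace ℝ (Fin m) → EuclideanSpace ℝ (Fin n) := φ ∘ P
  have hh : ContDiffAt ℝ ∞ h x :=
    ((contMDiffAt_of_mem_maximalAtlas hm hx).comp x hP).contDiffAt
  have hA : ContDiffAt ℝ ∞ (fun y ↦ ((α.toFun (φ.symm y)).compContinuousLinearMap
      (mfderiv (𝓡 n) (𝓡 n) φ.symm y) : EuclideanSpace ℝ (Fin n) [⋀^Fin k]→L[ℝ] ℝ)) (h x) :=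
    (α.smooth φ (chart_mem_atlas _ _)).contDiffAt
      (φ.open_target.mem_nhds (φ.map_source hx))
  have hD : ContDiffAt ℝ ∞ (fderiv ℝ h) x := hh.fderiv_right (by norm_cast)
  have key := contDiff_compContinuousLinearMap (r := ∞) (G := ℝ) (k := k)
    (F := EuclideanSpace ℝ (Fin n)) (E := EuclideanSpace ℝ (Fin m))
    |>.contDiffAt.comp x ((hA.comp x hh).prodMk hD)
  refine key.congr_of_eventuallyEq ?_
  have hev : ∀ᶠ y in 𝓝 x, P y ∈ φ.source :=
    hP.continuousAt.eventually (φ.open_source.mem_nhds hx)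
  have hev' : ∀ᶠ y in 𝓝 x, DifferentiableAt ℝ h y :=
    ((hh.of_le (m := 1) (by norm_cast)).eventually (by simp)).mono fun y hy ↦
      hy.differentiableAt (by simp)
  -- The derivative at `y` sees a neighbourhood of `y`, so `P` must stay in the chart domain near
  -- `y`, not only at `y`.
  filter_upwards [hev.eventually_nhds, hev'] with y hy hy'
  have e : P =ᶠ[𝓝 y] φ.symm ∘ h := hy.mono fun z hz ↦ (φ.left_inv hz).symm
  have hs : MDifferentiableAt (𝓡 n) (𝓡 n) φ.symm (h y) :=
    (contMDiffAt_symm_of_mem_maximalAtlas hm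
      (φ.map_source hy.self_of_nhds)).mdifferentiableAt (by simp)
  rw [α.pullbackAt_congr e, α.pullbackAt_comp hs hy'.mdifferentiableAt, mfderiv_eq_fderiv]
  rfl

end Pullback

/-! ### Plots of the manifold and of its quotient -/

section Plots

variable {n : ℕ} {M : Type*} [TopologicalSpace M] [ChartedSpace (EuclideanSpace ℝ (Fin n)) M]

/-- Plots on `U` are tested only by smooth maps from whole Cartesian spaces. `univBall` is a
diffeomorphism from the whole space onto a ball inside `U`, so testing with it and composing with
its inverse recovers smoothness on the ball. -/
lemma IsPlotOn.contMDiffOn {m : ℕ} {U : Opens (EuclideanSpace ℝ (Fin m))}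
    {P : EuclideanSpace ℝ (Fin m) → M} (hP : IsPlotOn (manifoldDiffeology n M) U P) :
    ContMDiffOn (𝓡 m) (𝓡 n) ∞ P U := by
  intro x hx
  obtain ⟨r, hr, hrU⟩ := Metric.isOpen_iff.1 U.isOpen x hx
  set u := OpenPartialHomeomorph.univBall x r
  have hu : ∀ y, u y ∈ Metric.ball x r := fun y ↦ by
    rw [← OpenPartialHomeomorph.univBall_target x hr]
    exact u.map_source (by simp [u])
  have h₁ : ContMDiff (𝓡 m) (𝓡 n) ∞ (P ∘ u) := contMDiffOn_univ.1
    (hP m u OpenPartialHomeomorph.contDiff_univBall fun y ↦ hrU (hu y))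
  have h₂ : ContMDiffOn (𝓡 m) (𝓡 n) ∞ ((P ∘ u) ∘ u.symm) (Metric.ball x r) :=
    h₁.comp_contMDiffOn OpenPartialHomeomorph.contDiffOn_univBall_symm.contMDiffOn
  have h₃ : ContMDiffOn (𝓡 m) (𝓡 n) ∞ P (Metric.ball x r) := h₂.congr fun y hy ↦ by
    have : u (u.symm y) = y :=
      u.right_inv (by rwa [OpenPartialHomeomorph.univBall_target x hr])
    simp [this]
  exact (h₃.contMDiffAt (Metric.ball_mem_nhds x hr)).contMDiffWithinAt

/-- Plots of the quotient locally lift to smooth maps. -/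
lemma IsPlotOn.exists_lift {m : ℕ} {r : Setoid M} {U : Opens (EuclideanSpace ℝ (Fin m))}
    {p : EuclideanSpace ℝ (Fin m) → Quotient r}
    (hp : IsPlotOn (quotientDiffeology (manifoldDiffeology n M) r) U p)
    {x : EuclideanSpace ℝ (Fin m)} (hx : x ∈ U) :
    ∃ V : Set (EuclideanSpace ℝ (Fin m)), IsOpen V ∧ x ∈ V ∧ V ⊆ U ∧
      ∃ q : EuclideanSpace ℝ (Fin m) → M,
        ContMDiffOn (𝓡 m) (𝓡 n) ∞ q V ∧ EqOn p (Quotient.mk r ∘ q) V := by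
  obtain ⟨ε, hε, hεU⟩ := Metric.isOpen_iff.1 U.isOpen x hx
  set u := OpenPartialHomeomorph.univBall x ε
  have ht : u.target = Metric.ball x ε := OpenPartialHomeomorph.univBall_target x hε
  have hu : ∀ y, u y ∈ Metric.ball x ε := fun y ↦ by
    rw [← ht]
    exact u.map_source (by simp [u])
  -- The composite `p ∘ u` is a plot on the whole space, hence lifts near `u.symm x`; the lift is
  -- carried back to the ball by `u.symm`.
  obtain ⟨W, hxW, -, q, hq, hqW⟩ := hp m u OpenPartialHomeomorph.contDiff_univBall
    (fun y ↦ hεU (hu y)) (u.symm x) (mem_univ _)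
  refine ⟨Metric.ball x ε ∩ u.symm ⁻¹' W, ?_, ⟨Metric.mem_ball_self hε, hxW⟩,
    inter_subset_left.trans hεU, q ∘ u.symm, ?_, fun y hy ↦ ?_⟩
  · rw [← ht]
    exact u.symm.isOpen_inter_preimage W.isOpen
  · exact hq.contMDiffOn.comp
      (OpenPartialHomeomorph.contDiffOn_univBall_symm.contMDiffOn.mono inter_subset_left)
      fun y hy ↦ hy.2
  · have h := hqW hy.2
    have : u (u.symm y) = y := u.right_inv (by rw [ht]; exact hy.1)
    simpa [this] using h

end Plots

/-! ### Transitions and pseudogroups defined by germ conditions -/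

section Transitions

variable {n : ℕ} {M : Type*} [TopologicalSpace M] [ChartedSpace (EuclideanSpace ℝ (Fin n)) M]

lemma IsTransition.contMDiffAt {e : OpenPartialHomeomorph M M} (he : IsTransition n e) {x : M}
    (hx : x ∈ e.source) : ContMDiffAt (𝓡 n) (𝓡 n) ∞ e x :=
  he.1.contMDiffAt (e.open_source.mem_nhds hx)

lemma IsTransition.symm {e : OpenPartialHomeomorph M M} (he : IsTransition n e) :
    IsTransition n e.symm :=
  ⟨he.2, he.1⟩

lemma IsTransition.trans {e e' : OpenPartialHomeomorph M M} (he : IsTransition n e)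
    (he' : IsTransition n e') : IsTransition n (e.trans e') := by
  constructor
  · rw [OpenPartialHomeomorph.trans_source]
    exact he'.1.comp (he.1.mono inter_subset_left) fun x hx ↦ hx.2
  · rw [OpenPartialHomeomorph.trans_target]
    exact he.2.comp (he'.2.mono inter_subset_left) fun x hx ↦ hx.2

lemma IsTransition.ofSet {s : Set M} (hs : IsOpen s) :
    IsTransition n (OpenPartialHomeomorph.ofSet s hs) :=
  ⟨contMDiffOn_id, contMDiffOn_id⟩

lemma IsTransition.of_eqOnSource {e e' : OpenPartialHomeomorph M M} (he : IsTransition n e)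
    (h : e' ≈ e) : IsTransition n e' :=
  ⟨h.1 ▸ he.1.congr fun _ hx ↦ h.2 (h.1 ▸ hx),
    h.target_eq ▸ he.2.congr fun _ hx ↦ h.symm_eqOn_target (h.target_eq ▸ hx)⟩

lemma IsTransition.of_locally {e : OpenPartialHomeomorph M M}
    (h : ∀ x ∈ e.source, ∃ s, IsOpen s ∧ x ∈ s ∧ IsTransition n (e.restr s)) :
    IsTransition n e := by
  constructor
  · intro x hx
    obtain ⟨s, hs, hxs, he⟩ := h x hx
    exact (he.contMDiffAt (x := x) (by simp [hs.interior_eq, hx, hxs])).contMDiffWithinAt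
  · intro y hy
    obtain ⟨s, hs, hxs, he⟩ := h _ (e.map_target hy)
    have hy' : y ∈ (e.restr s).target := by
      have := (e.restr s).map_source (x := e.symm y)
        (by simp [hs.interior_eq, e.map_target hy, hxs])
      simpa [e.right_inv hy] using this
    exact (he.symm.contMDiffAt hy').contMDiffWithinAt

variable (n) in
/-- The pseudogroup of all transitions whose germs have a property `R` that is stable under
composition and inversion. -/
def germPseudogroup (R : (M → M) → M → Prop)
    (hcongr : ∀ ⦃f g : M → M⦄ ⦃x : M⦄, f =ᶠ[𝓝 x] g → R f x → R g x)
    (hid : ∀ x, R id x)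
    (hcomp : ∀ ⦃f g : M → M⦄ ⦃x : M⦄, ContMDiffAt (𝓡 n) (𝓡 n) ∞ f x →
      ContMDiffAt (𝓡 n) (𝓡 n) ∞ g (f x) → R f x → R g (f x) → R (g ∘ f) x)
    (hsymm : ∀ e : OpenPartialHomeomorph M M, IsTransition n e → ∀ x ∈ e.source,
      R e x → R e.symm (e x)) : StructureGroupoid M where
  members := {e | IsTransition n e ∧ ∀ x ∈ e.source, R e x}
  trans' e e' he he' := ⟨he.1.trans he'.1, fun x hx ↦ by
    rw [OpenPartialHomeomorph.trans_source] at hx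
    exact hcomp (f := e) (g := e') (he.1.contMDiffAt hx.1) (he'.1.contMDiffAt hx.2) (he.2 x hx.1) (he'.2 _ hx.2)⟩
  symm' e he := ⟨he.1.symm, fun y hy ↦ by
    have h := hsymm e he.1 _ (e.map_target hy) (he.2 _ (e.map_target hy))
    rwa [e.right_inv hy] at h⟩
  id_mem' := ⟨⟨contMDiffOn_id, contMDiffOn_id⟩, fun x _ ↦ hid x⟩
  locality' e he := by
    refine ⟨.of_locally fun x hx ↦ ?_, fun x hx ↦ ?_⟩
    · obtain ⟨s, hs, hxs, h⟩ := he x hx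
      exact ⟨s, hs, hxs, h.1⟩
    · obtain ⟨s, hs, hxs, h⟩ := he x hx
      exact h.2 x (by simp [hs.interior_eq, hx, hxs])
  mem_of_eqOnSource' e e' he h := ⟨he.1.of_eqOnSource h, fun x hx ↦ by
    have hx' : x ∈ e.source := h.1 ▸ hx
    exact hcongr (h.2.symm.eventuallyEq_of_mem (e'.open_source.mem_nhds hx)) (he.2 x hx')⟩

/-- This yields an induction principle: a property `R` of this kind that holds for the generators
holds for every element of the pseudogroup they generate. -/
lemma isPseudogroup_germPseudogroup (R : (M → M) → M → Prop) (hcongr hid hcomp hsymm) :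
    IsPseudogroup n (germPseudogroup n R hcongr hid hcomp hsymm) where
  isTransition _ he := he.1
  id_mem U := ⟨.ofSet U.isOpen, fun x _ ↦ hid x⟩

end Transitions

/-! ### Words in the generators -/

section Words

variable {n : ℕ} {M : Type*} [TopologicalSpace M] [ChartedSpace (EuclideanSpace ℝ (Fin n)) M]

/-- The finite composites of transitions in `A` and their inverses. -/
inductive IsWord (A : Set (OpenPartialHomeomorph M M)) : OpenPartialHomeomorph M M → Prop
  | refl : IsWord A (.refl M)
  | trans {e a : OpenPartialHomeomorph M M} : IsWord A e → a ∈ A → IsWord A (e.trans a)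
  | trans_symm {e a : OpenPartialHomeomorph M M} :
      IsWord A e → a ∈ A → IsWord A (e.trans a.symm)

/-- A word is spelled by a finite list of generators with flags, `true` for the generator and
`false` for its inverse; there are countably many such lists. -/
lemma countable_isWord {A : Set (OpenPartialHomeomorph M M)} (hA : A.Countable) :
    {e | IsWord A e}.Countable := by
  have : Countable A := hA
  let step : OpenPartialHomeomorph M M → A × Bool → OpenPartialHomeomorph M M :=
    fun e a ↦ e.trans (if a.2 then a.1 else a.1.1.symm)
  refine (countable_range fun l : List (A × Bool) ↦ l.foldl step (.refl M)).mono ?_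
  intro e he
  induction he with
  | refl => exact ⟨[], rfl⟩
  | trans _ ha ih =>
    obtain ⟨l, rfl⟩ := ih
    exact ⟨l ++ [(⟨_, ha⟩, true)], by simp [step]⟩
  | trans_symm _ ha ih =>
    obtain ⟨l, rfl⟩ := ih
    exact ⟨l ++ [(⟨_, ha⟩, false)], by simp [step]⟩

lemma IsWord.trans_word {A : Set (OpenPartialHomeomorph M M)} {w w' : OpenPartialHomeomorph M M}
    (hw : IsWord A w) (hw' : IsWord A w') : IsWord A (w.trans w') := by
  induction hw' with
  | refl => simpa using hw
  | trans _ ha ih => rw [← OpenPartialHomeomorph.trans_assoc]; exact ih.trans ha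
  | trans_symm _ ha ih => rw [← OpenPartialHomeomorph.trans_assoc]; exact ih.trans_symm ha

lemma IsWord.symm {A : Set (OpenPartialHomeomorph M M)} {w : OpenPartialHomeomorph M M}
    (hw : IsWord A w) : IsWord A w.symm := by
  induction hw with
  | refl => exact .refl
  | trans _ ha ih =>
    rw [OpenPartialHomeomorph.trans_symm_eq_symm_trans_symm]
    refine IsWord.trans_word ?_ ih
    simpa using IsWord.refl.trans_symm ha
  | trans_symm _ ha ih =>
    rw [OpenPartialHomeomorph.trans_symm_eq_symm_trans_symm]
    refine IsWord.trans_word ?_ ih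
    simpa using IsWord.refl.trans ha

/-- A pseudogroup contains the words in its elements. -/
lemma IsWord.mem {A : Set (OpenPartialHomeomorph M M)} {P : StructureGroupoid M}
    (hA : ∀ a ∈ A, a ∈ P) {w : OpenPartialHomeomorph M M} (hw : IsWord A w) : w ∈ P := by
  induction hw with
  | refl => exact P.id_mem
  | trans _ ha ih => exact P.trans ih (hA _ ha)
  | trans_symm _ ha ih => exact P.trans ih (P.symm (hA _ ha))

/-- Elements of a generated pseudogroup coincide pointwise with words in the generators. -/
lemma exists_isWord_of_mem_generatedPseudogroup {A : Set (OpenPartialHomeomorph M M)}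
    (hA : ∀ a ∈ A, IsTransition n a) {e : OpenPartialHomeomorph M M}
    (he : e ∈ generatedPseudogroup n A) {x : M} (hx : x ∈ e.source) :
    ∃ w, IsWord A w ∧ x ∈ w.source ∧ w x = e x := by
  -- The property compares values at one point only. Agreement on an open set is recovered later by
  -- the Baire argument.
  refine (he _ (isPseudogroup_germPseudogroup
    (fun f x ↦ ∃ w, IsWord A w ∧ x ∈ w.source ∧ w x = f x) ?_ ?_ ?_ ?_)
    fun a ha ↦ ⟨hA a ha, fun x hx ↦ ⟨a, ?_, hx, rfl⟩⟩).2 x hx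
  · rintro f g x h ⟨w, hw, hxw, hwx⟩
    exact ⟨w, hw, hxw, hwx.trans h.eq_of_nhds⟩
  · exact fun x ↦ ⟨_, .refl, trivial, rfl⟩
  · rintro f g x - - ⟨w, hw, hxw, hwx⟩ ⟨w', hw', hxw', hwx'⟩
    refine ⟨w.trans w', hw.trans_word hw', ?_, ?_⟩
    · rw [OpenPartialHomeomorph.trans_source]
      exact ⟨hxw, by rwa [mem_preimage, hwx]⟩
    · simp [hwx, hwx']
  · rintro e - x hx ⟨w, hw, hxw, hwx⟩
    refine ⟨w.symm, hw.symm, ?_, ?_⟩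
    · rw [← hwx]
      exact w.map_source hxw
    · rw [e.left_inv hx, ← hwx, w.left_inv hxw]
  · simpa using IsWord.refl.trans ha

end Words

/-! ### Transitions preserving a form -/

section Invariance

variable {n k : ℕ} {M : Type*} [TopologicalSpace M] [ChartedSpace (EuclideanSpace ℝ (Fin n)) M]

/-- The pseudogroup of transitions that preserve a differential form. -/
def DifferentialForm.stabilizer (α : DifferentialForm n M k) : StructureGroupoid M :=
  germPseudogroup n (fun f x ↦ α.pullbackAt (m := n) f x = α.toFun x)
    (fun f g x h hf ↦ (α.pullbackAt_congr h).symm.trans hf)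
    (fun x ↦ α.pullbackAt_id x)
    (fun f g x hf hg h h' ↦ by
      rw [← α.pullbackAt_id] at h'
      have := α.pullbackAt_comp_of_eq (hg.mdifferentiableAt (by simp)) mdifferentiableAt_id
        (hf.mdifferentiableAt (by simp)) h'
      exact this.trans h)
    (fun e he x hx h ↦ by
      have hs : ContMDiffAt (𝓡 n) (𝓡 n) ∞ e.symm (e x) := he.symm.contMDiffAt (e.map_source hx)
      have hl : e.symm (e x) = x := e.left_inv hx
      have he' : ContMDiffAt (𝓡 n) (𝓡 n) ∞ e (e.symm (e x)) := by
        rw [hl]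
        exact he.contMDiffAt hx
      have h' : α.pullbackAt (m := n) e (e.symm (e x)) =
          α.pullbackAt (m := n) id (e.symm (e x)) := by
        rw [hl, α.pullbackAt_id, h]
      -- Pulling `e^* α = α` back along `e.symm` gives `(e ∘ e.symm)^* α = e.symm^* α`, and the left
      -- side is `α`.
      have := α.pullbackAt_comp_of_eq (he'.mdifferentiableAt (by simp)) mdifferentiableAt_id
        (hs.mdifferentiableAt (by simp)) h'
      have hr : e ∘ e.symm =ᶠ[𝓝 (e x)] id := e.eventually_right_inverse (e.map_source hx)
      rw [Function.id_comp, α.pullbackAt_congr hr, α.pullbackAt_id] at this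
      exact this.symm)

lemma DifferentialForm.isPseudogroup_stabilizer (α : DifferentialForm n M k) :
    IsPseudogroup n α.stabilizer :=
  isPseudogroup_germPseudogroup _ _ _ _ _

lemma DifferentialForm.mem_stabilizer_iff (α : DifferentialForm n M k)
    {e : OpenPartialHomeomorph M M} : e ∈ α.stabilizer ↔
      IsTransition n e ∧ ∀ x ∈ e.source, α.pullbackAt (m := n) e x = α.toFun x :=
  Iff.rfl

end Invariance

/-! ### Bisections of an étale groupoid -/

section Groupoid

lemma Arrows.inv_inv {M : Type*} [Groupoid M] (g : Arrows M) : g.inv.inv = g := by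
  simp [Arrows.inv]

variable {n m k : ℕ} {M : Type*} [Groupoid M] [TopologicalSpace M]
  [ChartedSpace (EuclideanSpace ℝ (Fin n)) M]
  [TopologicalSpace (Arrows M)] [ChartedSpace (EuclideanSpace ℝ (Fin m)) (Arrows M)]

/-- With `e = t ∘ σ` and `s ∘ σ = id`, one has `e^* α = σ^* t^* α = σ^* s^* α = α`. -/
lemma bisectionTransitions_subset_stabilizer (hG : IsLieGroupoid M n m)
    {α : DifferentialForm n M k} (hα : IsBasic m α) {e : OpenPartialHomeomorph M M}
    (he : e ∈ bisectionTransitions M n m) : e ∈ α.stabilizer := by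
  obtain ⟨ht, σ, hσ, h⟩ := he
  refine ⟨ht, fun x hx ↦ ?_⟩
  have hn := e.open_source.mem_nhds hx
  have h₁ : Arrows.source ∘ σ =ᶠ[𝓝 x] id := by
    filter_upwards [hn] with y hy using (h y hy).1
  have h₂ : Arrows.target ∘ σ =ᶠ[𝓝 x] e := by
    filter_upwards [hn] with y hy using (h y hy).2
  change α.pullbackAt (m := n) e x = α.toFun x
  rw [← α.pullbackAt_congr h₂, ← α.pullbackAt_id, ← α.pullbackAt_congr h₁]
  exact α.pullbackAt_comp_of_eq (hG.contMDiff_target.mdifferentiableAt (by simp))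
    (hG.contMDiff_source.mdifferentiableAt (by simp))
    ((hσ.contMDiffAt hn).mdifferentiableAt (by simp)) (hα (σ x)).symm

/-- Through every arrow of an étale groupoid passes a bisection. -/
lemma exists_mem_bisectionTransitions (hG : IsLieGroupoid M n m) (hetale : IsEtale M n m)
    (g : Arrows M) : ∃ e ∈ bisectionTransitions M n m, g.source ∈ e.source ∧
      e g.source = g.target := by
  obtain ⟨Φ, hgΦ, hΦ⟩ := hetale g
  -- Since `t = s ∘ inv`, étaleness of `s` at `g.inv` makes `t` a local diffeomorphism at `g`. The
  -- transition `χ` is `t` after the local section `Φ.symm` of `s` through `g`.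
  obtain ⟨Ψ, hgΨ, hΨ⟩ := hetale g.inv
  let ι : PartialDiffeomorph (𝓡 m) (𝓡 m) (Arrows M) (Arrows M) ∞ :=
    { toFun := Arrows.inv
      invFun := Arrows.inv
      source := univ
      target := univ
      map_source' := fun _ _ ↦ trivial
      map_target' := fun _ _ ↦ trivial
      left_inv' := fun g _ ↦ g.inv_inv
      right_inv' := fun g _ ↦ g.inv_inv
      open_source := isOpen_univ
      open_target := isOpen_univ
      contMDiffOn_toFun := hG.contMDiff_inv.contMDiffOn
      contMDiffOn_invFun := hG.contMDiff_inv.contMDiffOn }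
  let χ := Φ.symm.trans (ι.trans Ψ)
  have hsub : ∀ x ∈ χ.source, x ∈ Φ.target ∧ (Φ.symm x).inv ∈ Ψ.source := fun x hx ↦
    ⟨hx.1, hx.2.2⟩
  have hΦg : Φ g = g.source := (hΦ hgΦ).symm
  have hσg : Φ.symm g.source = g := by
    rw [← hΦg]
    exact Φ.left_inv hgΦ
  have hgs : g.source ∈ Φ.target := hΦg ▸ Φ.map_source hgΦ
  refine ⟨χ.toOpenPartialHomeomorph,
    ⟨⟨χ.contMDiffOn_toFun, χ.contMDiffOn_invFun⟩, Φ.symm,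
      Φ.symm.contMDiffOn_toFun.mono fun x hx ↦ (hsub x hx).1, fun x hx ↦ ⟨?_, ?_⟩⟩, ?_, ?_⟩
  · exact (hΦ (Φ.map_target (hsub x hx).1)).trans (Φ.right_inv (hsub x hx).1)
  · exact hΨ (hsub x hx).2
  · refine ⟨hgs, trivial, ?_⟩
    change (Φ.symm g.source).inv ∈ Ψ.source
    rwa [hσg]
  · change Ψ (Φ.symm g.source).inv = g.target
    rw [hσg, ← hΨ hgΨ]
    rfl

end Groupoid

/-! ### Baire category for locally closed covers -/

section Baire

/-- A nonempty open subset of a Baire space that is covered by countably many locally closed sets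
meets the interior of one of them. -/
lemma exists_inter_interior_nonempty_of_isLocallyClosed {X ι : Type*} [TopologicalSpace X]
    [BaireSpace X] [Countable ι] {O : Set X} (hO : IsOpen O) (hne : O.Nonempty) {C : ι → Set X}
    (hC : ∀ i, IsLocallyClosed (C i)) (hcover : O ⊆ ⋃ i, C i) :
    ∃ i, (O ∩ interior (C i)).Nonempty := by
  -- The closed set `Oᶜ` is added under the index `none` so that the family covers the whole space.
  let f : Option ι → Set X := fun i ↦ i.elim Oᶜ fun i ↦ closure (C i)
  have hf : ∀ i, IsClosed (f i) := by
    rintro (_ | i)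
    exacts [hO.isClosed_compl, isClosed_closure]
  have hU : ⋃ i, f i = univ := by
    refine eq_univ_of_forall fun x ↦ ?_
    by_cases hx : x ∈ O
    · obtain ⟨i, hi⟩ := mem_iUnion.1 (hcover hx)
      exact mem_iUnion.2 ⟨some i, subset_closure hi⟩
    · exact mem_iUnion.2 ⟨none, hx⟩
  obtain ⟨x, hxO, hx⟩ := (dense_iUnion_interior_of_closed hf hU).inter_open_nonempty O hO hne
  obtain ⟨_ | i, hi⟩ := mem_iUnion.1 hx
  · exact absurd hxO (interior_subset hi)
  -- A locally closed set `W ∩ Z` is open in its closure: inside the open set `W`, the interior of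
  -- the closure lies in `C i`.
  · obtain ⟨W, Z, hW, hZ, hWZ⟩ := hC i
    have hi' : x ∈ interior (closure (C i)) := hi
    obtain ⟨y, hyB, hyC⟩ := mem_closure_iff.1 (interior_subset hi') (O ∩ interior (closure (C i)))
      (hO.inter isOpen_interior) ⟨hxO, hi'⟩
    refine ⟨i, y, hyB.1, ?_⟩
    refine mem_interior.2 ⟨interior (closure (C i)) ∩ W, fun z hz ↦ ?_,
      isOpen_interior.inter hW, hyB.2, (hWZ ▸ hyC : y ∈ W ∩ Z).1⟩
    have : closure (C i) ⊆ Z := closure_minimal (hWZ ▸ inter_subset_right) hZ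
    rw [hWZ]
    exact ⟨hz.2, this (interior_subset hz.1)⟩

/-- As `Y` is Hausdorff, the coincidence set is closed relative to the open set `W`. It need not be
closed in `X`, which is why the Baire argument is phrased for locally closed sets. -/
lemma isLocallyClosed_setOf_eq_of_continuousOn {X Y : Type*} [TopologicalSpace X]
    [TopologicalSpace Y] [T2Space Y] {W : Set X} (hW : IsOpen W) {f g : X → Y}
    (hf : ContinuousOn f W) (hg : ContinuousOn g W) :
    IsLocallyClosed {x | x ∈ W ∧ f x = g x} := by
  have h : IsOpen (W ∩ (fun x ↦ (f x, g x)) ⁻¹' (diagonal Y)ᶜ) :=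
    (hf.prodMk hg).isOpen_inter_preimage hW isClosed_diagonal.isOpen_compl
  refine ⟨W, _, hW, h.isClosed_compl, ?_⟩
  ext x
  simp only [mem_ofPred_eq, mem_inter_iff, mem_compl_iff, mem_preimage, mem_diagonal_iff, not_and,
    not_not]
  tauto

end Baire

/-! ### Independence of the lift and descent of the form -/

section Main

variable {n m k l : ℕ} {M : Type*} [Groupoid M] [TopologicalSpace M]
  [ChartedSpace (EuclideanSpace ℝ (Fin n)) M]
  [TopologicalSpace (Arrows M)] [ChartedSpace (EuclideanSpace ℝ (Fin m)) (Arrows M)]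

/-- Smooth maps to `M` with the same projection to the orbit space pull a basic form back to the
same form. -/
lemma pullbackAt_eq_of_eqOn_quotient (hG : IsLieGroupoid M n m) (hetale : IsEtale M n m)
    (hcount : IsCountablyGenerated n (associatedPseudogroup M n m))
    {α : DifferentialForm n M k} (hα : IsBasic m α) {V : Set (EuclideanSpace ℝ (Fin l))}
    (hV : IsOpen V) {P Q : EuclideanSpace ℝ (Fin l) → M}
    (hP : ContMDiffOn (𝓡 l) (𝓡 n) ∞ P V) (hQ : ContMDiffOn (𝓡 l) (𝓡 n) ∞ Q V)
    (hPQ : EqOn (Quotient.mk (orbitSetoid M) ∘ P) (Quotient.mk (orbitSetoid M) ∘ Q) V)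
    {x : EuclideanSpace ℝ (Fin l)} (hx : x ∈ V) :
    α.pullbackAt (m := l) P x = α.pullbackAt (m := l) Q x := by
  have := hG.base_t2
  have := hG.base_isManifold
  obtain ⟨A, hAc, hAt, hA⟩ := hcount
  have hgen : ∀ e ∈ bisectionTransitions M n m, e ∈ generatedPseudogroup n A := fun e he ↦ by
    rw [hA]
    exact fun _ _ h ↦ h e he
  -- The generators in `A` need not come from bisections. They lie in the smallest pseudogroup
  -- containing the bisection transitions, hence in the stabilizer of `α`.
  have hstab : ∀ a ∈ A, a ∈ α.stabilizer := fun a ha ↦ by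
    have ha' : a ∈ associatedPseudogroup M n m := by
      rw [← hA]
      exact fun _ _ h ↦ h a ha
    exact ha' _ α.isPseudogroup_stabilizer fun e ↦ bisectionTransitions_subset_stabilizer hG hα
  have : Countable {e | IsWord A e} := countable_isWord hAc
  have hcont : ∀ {R : EuclideanSpace ℝ (Fin l) → M}, ContMDiffOn (𝓡 l) (𝓡 n) ∞ R V →
      ContinuousOn (Y := EuclideanSpace ℝ (Fin l) [⋀^Fin k]→L[ℝ] ℝ)
        (fun y ↦ α.pullbackAt (m := l) R y) V := fun hR y hy ↦
    (α.contDiffAt_pullbackAt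
      (hR.contMDiffAt (hV.mem_nhds hy))).continuousAt.continuousWithinAt
  let O : Set (EuclideanSpace ℝ (Fin l)) :=
    V ∩ {y | α.pullbackAt (m := l) P y ≠ α.pullbackAt (m := l) Q y}
  have hO : IsOpen O :=
    ((hcont hP).prodMk (hcont hQ)).isOpen_inter_preimage hV isClosed_diagonal.isOpen_compl
  by_contra hne
  have hW : ∀ w : {e | IsWord A e}, IsOpen (O ∩ P ⁻¹' w.1.source) := fun w ↦
    (hP.continuousOn.mono inter_subset_left).isOpen_inter_preimage hO w.1.open_source
  obtain ⟨w, y, hyO, hy⟩ := exists_inter_interior_nonempty_of_isLocallyClosed hO ⟨x, hx, hne⟩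
    (C := fun w : {e | IsWord A e} ↦ {y | y ∈ O ∩ P ⁻¹' w.1.source ∧ w.1 (P y) = Q y})
    (fun w ↦ isLocallyClosed_setOf_eq_of_continuousOn (hW w)
      (w.1.continuousOn.comp (hP.continuousOn.mono fun y hy ↦ hy.1.1) fun y hy ↦ hy.2)
      (hQ.continuousOn.mono fun y hy ↦ hy.1.1))
    -- The cover: an arrow from `P y` to `Q y` lies on a bisection, whose transition agrees at `P y`
    -- with some word.
    (fun y hy ↦ by
      obtain ⟨g⟩ : Nonempty (P y ⟶ Q y) := Quotient.exact (hPQ hy.1)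
      obtain ⟨e, he, hye, hey⟩ := exists_mem_bisectionTransitions hG hetale ⟨P y, Q y, g⟩
      obtain ⟨w, hw, hyw, hwy⟩ :=
        exists_isWord_of_mem_generatedPseudogroup hAt (hgen e he) hye
      exact mem_iUnion.2 ⟨⟨w, hw⟩, ⟨hy, hyw⟩, hwy.trans hey⟩)
  have hws := α.mem_stabilizer_iff.1 (w.2.mem hstab)
  have hPy : P y ∈ w.1.source := (interior_subset hy).1.2
  have hev : w.1 ∘ P =ᶠ[𝓝 y] Q := by
    filter_upwards [mem_interior_iff_mem_nhds.1 hy] with z hz using hz.2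
  -- Near `y`, `Q` is `w ∘ P` with `w` preserving `α`, so the pullbacks agree at `y`, although `y ∈
  -- O`.
  refine hyO.2 ?_
  rw [← α.pullbackAt_congr hev]
  have h := hws.2 _ hPy
  rw [← α.pullbackAt_id] at h
  exact (α.pullbackAt_comp_of_eq ((hws.1.contMDiffAt hPy).mdifferentiableAt (by simp))
    mdifferentiableAt_id
    ((hP.contMDiffAt (hV.mem_nhds hyO.1)).mdifferentiableAt (by simp)) h).symm

/-- Local lifts of a map to the orbit space pull a basic form back to the same form. -/
lemma pullbackAt_eq_of_lifts (hG : IsLieGroupoid M n m) (hetale : IsEtale M n m)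
    (hcount : IsCountablyGenerated n (associatedPseudogroup M n m))
    {α : DifferentialForm n M k} (hα : IsBasic m α)
    {p : EuclideanSpace ℝ (Fin l) → Quotient (orbitSetoid M)}
    {V W : Set (EuclideanSpace ℝ (Fin l))} (hV : IsOpen V) (hW : IsOpen W)
    {P Q : EuclideanSpace ℝ (Fin l) → M}
    (hP : ContMDiffOn (𝓡 l) (𝓡 n) ∞ P V) (hQ : ContMDiffOn (𝓡 l) (𝓡 n) ∞ Q W)
    (hpP : EqOn p (Quotient.mk (orbitSetoid M) ∘ P) V)
    (hpQ : EqOn p (Quotient.mk (orbitSetoid M) ∘ Q) W)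
    {x : EuclideanSpace ℝ (Fin l)} (hxV : x ∈ V) (hxW : x ∈ W) :
    α.pullbackAt (m := l) P x = α.pullbackAt (m := l) Q x :=
  pullbackAt_eq_of_eqOn_quotient hG hetale hcount hα (hV.inter hW) (hP.mono inter_subset_left)
    (hQ.mono inter_subset_right) (fun _ hy ↦ (hpP hy.1).symm.trans (hpQ hy.2)) ⟨hxV, hxW⟩

open Classical in
/-- The value at a point of the form on the orbit space induced by `α`: the pullback of `α` along a
local lift. -/
noncomputable def quotientFormAt (α : DifferentialForm n M k)
    {U : Opens (EuclideanSpace ℝ (Fin l))}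
    {p : EuclideanSpace ℝ (Fin l) → Quotient (orbitSetoid M)}
    (hp : IsPlotOn (quotientDiffeology (manifoldDiffeology n M) (orbitSetoid M)) U p)
    (x : EuclideanSpace ℝ (Fin l)) : EuclideanSpace ℝ (Fin l) [⋀^Fin k]→L[ℝ] ℝ :=
  -- The lift is chosen separately for each `x`, with no coherence between choices. The value `0`
  -- off `U` is immaterial, as a form on `U` is constrained only there.
  if hx : x ∈ U then α.pullbackAt (m := l) (hp.exists_lift hx).choose_spec.2.2.2.choose x else 0

/-- Independence of the lift replaces the arbitrary pointwise choices by one lift on an open set.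
Smoothness, compatibility with reparametrization and `π^* β = α` all follow from this. -/
lemma quotientFormAt_eq (hG : IsLieGroupoid M n m) (hetale : IsEtale M n m)
    (hcount : IsCountablyGenerated n (associatedPseudogroup M n m))
    {α : DifferentialForm n M k} (hα : IsBasic m α)
    {U : Opens (EuclideanSpace ℝ (Fin l))}
    {p : EuclideanSpace ℝ (Fin l) → Quotient (orbitSetoid M)}
    (hp : IsPlotOn (quotientDiffeology (manifoldDiffeology n M) (orbitSetoid M)) U p)
    {V : Set (EuclideanSpace ℝ (Fin l))} (hV : IsOpen V) {P : EuclideanSpace ℝ (Fin l) → M}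
    (hP : ContMDiffOn (𝓡 l) (𝓡 n) ∞ P V) (hpP : EqOn p (Quotient.mk (orbitSetoid M) ∘ P) V)
    {x : EuclideanSpace ℝ (Fin l)} (hxU : x ∈ U) (hxV : x ∈ V) :
    quotientFormAt α hp x = α.pullbackAt (m := l) P x := by
  have h := (hp.exists_lift hxU).choose_spec
  exact (dif_pos hxU).trans (pullbackAt_eq_of_lifts hG hetale hcount hα h.1 hV
    h.2.2.2.choose_spec.1 hP h.2.2.2.choose_spec.2 hpP h.2.1 hxV)

/-- The diffeological form on the orbit space induced by a basic form. -/
noncomputable def quotientForm (hG : IsLieGroupoid M n m) (hetale : IsEtale M n m)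
    (hcount : IsCountablyGenerated n (associatedPseudogroup M n m))
    {α : DifferentialForm n M k} (hα : IsBasic m α) :
    DiffeologicalForm (quotientDiffeology (manifoldDiffeology n M) (orbitSetoid M)) k where
  toFun _ _ hp := quotientFormAt α hp
  smooth U p hp x hx := by
    have := hG.base_isManifold
    obtain ⟨V, hV, hxV, hVU, P, hP, hpP⟩ := hp.exists_lift hx
    refine ((α.contDiffAt_pullbackAt (hP.contMDiffAt (hV.mem_nhds hxV))).congr_of_eventuallyEq
      ?_).contDiffWithinAt
    filter_upwards [hV.mem_nhds hxV] with y hy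
    exact quotientFormAt_eq hG hetale hcount hα hp hV hP hpP (hVU hy) hy
  pullback := fun {a b} V U q p hq hp F hF hFVU hqp x hx ↦ by
    obtain ⟨W, hW, hxW, hWU, P, hP, hpP⟩ := hp.exists_lift (hFVU hx)
    have hopen : IsOpen ((V : Set _) ∩ F ⁻¹' W) :=
      hF.continuousOn.isOpen_inter_preimage V.isOpen hW
    -- If `P` lifts `p` on `W`, then `P ∘ F` lifts `q` on `V ∩ F⁻¹ W`; the chain rule concludes.
    rw [quotientFormAt_eq hG hetale hcount hα hp hW hP hpP (hFVU hx) hxW,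
      quotientFormAt_eq hG hetale hcount hα hq hopen
        (hP.comp (hF.contMDiffOn.mono inter_subset_left) fun y hy ↦ hy.2)
        (fun y hy ↦ (hqp hy.1).trans (hpP hy.2)) hx ⟨hx, hxW⟩,
      α.pullbackAt_comp ((hP.contMDiffAt (hW.mem_nhds hxW)).mdifferentiableAt (by simp))
        ((hF.contDiffAt (V.isOpen.mem_nhds hx)).differentiableAt (by simp)).mdifferentiableAt,
      mfderiv_eq_fderiv]
    rfl

end Main

end EtaleForms

open EtaleForms
theorem lemma2 {n m : ℕ} {M : Type*} [Groupoid M]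
    [TopologicalSpace M] [ChartedSpace (EuclideanSpace ℝ (Fin n)) M]
    [TopologicalSpace (Arrows M)] [ChartedSpace (EuclideanSpace ℝ (Fin m)) (Arrows M)]
    (hG : IsLieGroupoid M n m) (hetale : IsEtale M n m)
    (hcount : IsCountablyGenerated n (associatedPseudogroup M n m))
    {k : ℕ} (α : DifferentialForm n M k) (hα : IsBasic m α) :
    ∃ β : DiffeologicalForm (quotientDiffeology (manifoldDiffeology n M) (orbitSetoid M)) k,
      IsQuotientPullback (orbitSetoid M) β α :=
  -- A plot `P` of `M` is itself a lift of `π ∘ P` over all of `U`.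
  ⟨quotientForm hG hetale hcount hα, fun _ U _ hP _ hx ↦
    quotientFormAt_eq hG hetale hcount hα
      (hP.mk_comp _) U.isOpen hP.contMDiffOn (fun _ _ ↦ rfl) hx hx⟩
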